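/- There exist a probability space $(\Omega,\mathcal F,P)$ and a real-valued stochastic process $(B_t)_{t\ge 0}$ on it (each $B_t$ being measurable) such that: 1. for every $\omega\in\Omega$ the path $t\mapsto B_t(\omega)$ is continuous on $\mathbb R_+=[0,\infty)$, and $B_0(\omega)=0$; 2. for all $n\in\mathbb N$ and $t_1,\dots,t_n\in\mathbb R_+$, the vector $(B_{t_1},\dots,B_{t_n})$ has the multivariate Gaussian law with mean $0$ and covariance matrix $(t_i\wedge t_j)_{1\le i,j\le n}$, where $t_i\wedge t_j=\min(t_i,t_j)$; in particular $B$ is a Brownian motion, i.e. it has these finite-dimensional laws and almost surely continuous paths; 3. for every $\omega\in\Omega$ and every $\gamma\in(0,1/2)$, the path $t\mapsto B_t(\omega)$ is locally $\gamma$-Hölder continuous, i.e. every $t\in\mathbb R_+$ has a neighborhood $U$ in $\mathbb R_+$ for which there is a constant $C$ with $|B_s(\omega)-B_r(\omega)|\le C|s-r|^\gamma$ for all $r,s\in U$; 4. the map $\omega\mapsto B_\cdot(\omega)$ from $\Omega$ to $C(\mathbb R_+,\mathbb R)$ is measurable, where $C(\mathbb R_+,\mathbb R)$ carries the Borel $\sigma$-algebra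 of the topology of uniform convergence on compact sets, and its law is the Wiener measure: it is the unique measure on $C(\mathbb R_+,\mathbb R)$ under which the coordinate process $(f\mapsto f(t))_{t\ge0}$ is a Brownian motion. -/

import Mathlib

open MeasureTheory ProbabilityTheory Topology
open scoped NNReal

/-- The covariance matrix `(tᵢ ∧ tⱼ)ᵢⱼ` attached to times `t₁, …, tₙ ≥ 0`. -/
def brownianCov {n : ℕ} (t : Fin n → ℝ≥0) : Matrix (Fin n) (Fin n) ℝ :=
  Matrix.of fun i j => ((min (t i) (t j) : ℝ≥0) : ℝ)

/-- `brownianCov t` is positive semidefinite, so that the Gaussian law with this covariance matrix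
is well defined (no default value is involved). -/
theorem brownianCov_posSemidef {n : ℕ} (t : Fin n → ℝ≥0) : (brownianCov t).PosSemidef := by
  have h : brownianCov t = (BrownianReal.covMatrix (Finset.univ.image t)).submatrix
      (fun i => ⟨t i, by simp⟩) (fun i => ⟨t i, by simp⟩) := by
    ext i j
    simp [brownianCov]
  rw [h]
  exact (BrownianReal.posSemidef_covMatrix _).submatrix _

/-- `f` is locally Hölder continuous of order `γ`: every point has a neighborhood on which `f` is
`γ`-Hölder (with a constant that may depend on the neighborhood). -/
def IsLocallyHolder {T E : Type*} [PseudoEMetricSpace T] [PseudoEMetricSpace E]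
    (γ : ℝ≥0) (f : T → E) : Prop :=
  ∀ t : T, ∃ U ∈ 𝓝 t, ∃ C : ℝ≥0, HolderOnWith C γ f U

/-- The Borel σ-algebra on `C(ℝ₊, ℝ)`. The topology is Mathlib's compact-open topology, i.e. the
topology of uniform convergence on compact sets. -/
instance instMeasurableSpacePaths : MeasurableSpace C(ℝ≥0, ℝ) := borel C(ℝ≥0, ℝ)

instance instBorelSpacePaths : BorelSpace C(ℝ≥0, ℝ) := ⟨rfl⟩

/-- A real process with continuous paths, seen as a map into `C(ℝ₊, ℝ)`. -/
def pathMap {Ω : Type*} (B : ℝ≥0 → Ω → ℝ) (hB : ∀ ω, Continuous fun t => B t ω) :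
    Ω → C(ℝ≥0, ℝ) :=
  fun ω => ⟨fun t => B t ω, hB ω⟩

/-- `W` is a Wiener measure on `C(ℝ₊, ℝ)` if the coordinate process `(f ↦ f t)_{t ≥ 0}` is a
Brownian motion under `W`. -/
def IsWienerMeasure (W : Measure C(ℝ≥0, ℝ)) : Prop :=
  IsBrownianReal (fun (t : ℝ≥0) (f : C(ℝ≥0, ℝ)) => f t) W

/-!
Brownian motion is constructed as a locally Hölder modification of a Gaussian process, and the
Wiener measure as its law.

* A linear isometry `W` from `L²(ℝ)` to a space of square integrable random variables, sending a
  Hilbert basis to independent standard Gaussian variables, takes only centered Gaussian values: this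
  holds for finite combinations of the basis, and it passes to `L²` limits
  (`exists_isonormal`). Then `X t = W (1_[0, t])` is a Gaussian process whose covariance is
  `⟪1_[0, s], 1_[0, t]⟫ = min s t` (`exists_isPreBrownianReal`), so no extension theorem for
  projective families is needed.
* By scaling, the increment of `X` over an interval of length `2 ^ (-m)` has moment of order
  `2 (n + 2)` proportional to `2 ^ (-m (n + 2))`. There are `N 2 ^ m` such intervals up to time `N`,
  so the sum of these powers over all dyadic intervals, weighted by `2 ^ (m n)`, has finite
  expectation and is almost surely finite (`ae_dyadicVariation_lt_top`). On the corresponding event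
  the increments of level `m` are `O(2 ^ (-γ m))` for each `γ ≤ n / (2 (n + 2))`, hence, varying `n`,
  for each `γ < 1 / 2`. Off that event `X` is replaced by `0`.
* Let `B t` be the limit of `X` along the dyadic approximations of `t` from below. Consecutive
  approximations are equal or adjacent dyadic numbers, so the limit exists for each `t`, and the
  geometric bounds make it locally `γ`-Hölder (`isLocallyHolder_of_tendsto_dyadicFloor`). Since `X`
  is continuous in `L²`, Fatou's lemma shows that `B t = X t` almost surely
  (`ae_eq_of_tendsto_dyadicFloor`).
* The Borel σ-algebra of `C(ℝ₊, ℝ)` is generated by the evaluations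
  (`borel_continuousMap_eq_comap`). So the path map is measurable, and a law on `C(ℝ₊, ℝ)` is
  determined by its finite-dimensional laws.
-/

/-! ### The isonormal process of a Hilbert space -/

section Isonormal

open Filter
open scoped RealInnerProductSpace InnerProductSpace

universe u

variable {Ω : Type*} {mΩ : MeasurableSpace Ω} {P : Measure Ω}

theorem L2_norm_sq_eq_integral (Y : Lp ℝ 2 P) : ‖Y‖ ^ 2 = ∫ ω, Y ω ^ 2 ∂P := by
  rw [← real_inner_self_eq_norm_sq, L2.inner_def]
  simp [pow_two]

theorem hasLaw_gaussianReal_of_hasGaussianLaw_L2 [IsProbabilityMeasure P] {Y : Lp ℝ 2 P}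
    (hY : HasGaussianLaw Y P) (h0 : P[Y] = 0) : HasLaw Y (gaussianReal 0 (‖Y‖₊ ^ 2)) P := by
  refine ⟨hY.aemeasurable, ?_⟩
  rw [hY.map_eq_gaussianReal, h0, variance_of_integral_eq_zero hY.aemeasurable h0,
    ← L2_norm_sq_eq_integral]
  congr 1
  ext
  simp

/-- Characteristic functions are continuous along `L²` convergence, and centered Gaussian laws are
determined by their variance, here the squared `L²` norm. -/
theorem isClosed_setOf_hasLaw_gaussianReal_norm_sq [IsProbabilityMeasure P] :
    IsClosed {Y : Lp ℝ 2 P | HasLaw Y (gaussianReal 0 (‖Y‖₊ ^ 2)) P} := by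
  refine IsSeqClosed.isClosed fun Y Z hY hYZ ↦ ⟨(Lp.aestronglyMeasurable Z).aemeasurable, ?_⟩
  have : IsProbabilityMeasure (P.map Z) :=
    Measure.isProbabilityMeasure_map (Lp.aestronglyMeasurable Z).aemeasurable
  have hlim := ((tendstoInMeasure_of_tendsto_Lp hYZ).tendstoInDistribution fun n ↦
    (hY n).aemeasurable).tendsto
  refine Measure.ext_of_charFun (funext fun t ↦ ?_)
  refine tendsto_nhds_unique (ProbabilityMeasure.tendsto_iff_tendsto_charFun.1 hlim t) ?_
  simp only [ProbabilityMeasure.coe_mk, (hY _).map_eq, charFun_gaussianReal]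
  have hn : Tendsto (fun n ↦ ‖Y n‖) atTop (𝓝 ‖Z‖) := hYZ.norm
  have hn' : Tendsto (fun n ↦ ((‖Y n‖ : ℝ) : ℂ)) atTop (𝓝 (‖Z‖ : ℂ)) :=
    (Complex.continuous_ofReal.tendsto _).comp hn
  refine (Complex.continuous_exp.tendsto _).comp (tendsto_const_nhds.sub ?_)
  simpa using ((hn'.pow 2).mul_const ((t : ℂ) ^ 2)).div_const 2

/-- **Isonormal process**: over every real Hilbert space `H` there is a linear isometry from `H` to
the square integrable random variables of some probability space whose values are all centered
Gaussian. It sends the vectors of a Hilbert basis to independent standard Gaussian variables. -/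
theorem exists_isonormal (H : Type u) [NormedAddCommGroup H] [InnerProductSpace ℝ H]
    [CompleteSpace H] :
    ∃ (Ω : Type u) (_ : MeasurableSpace Ω) (P : Measure Ω) (W : H →ₗᵢ[ℝ] Lp ℝ 2 P),
      IsProbabilityMeasure P ∧ ∀ h, HasLaw (W h) (gaussianReal 0 (‖h‖₊ ^ 2)) P := by
  obtain ⟨w, b, -⟩ := exists_hilbertBasis ℝ H
  obtain ⟨Ω, mΩ, P, ξ, hm, hlaw, hind, hP⟩ := exists_iid w (gaussianReal 0 1)
  have hG i : HasGaussianLaw (ξ i) P := (hlaw i).hasGaussianLaw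
  let v : w → Lp ℝ 2 P := fun i ↦ (hG i).memLp_two.toLp (ξ i)
  have hv i : v i =ᵐ[P] ξ i := MemLp.coeFn_toLp _
  have hmean i : P[ξ i] = 0 := by rw [(hlaw i).integral_eq]; simp
  have horth : Orthonormal ℝ v := by
    classical
    rw [orthonormal_iff_ite]
    intro i j
    have hinner : ⟪v i, v j⟫_ℝ = ∫ ω, ξ i ω * ξ j ω ∂P := by
      rw [L2.inner_def]
      refine integral_congr_ae ?_
      filter_upwards [hv i, hv j] with ω hi hj
      simp [hi, hj, mul_comm]
    rw [hinner]
    split_ifs with hij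
    · subst hij
      have h1 := variance_of_integral_eq_zero (hG i).aemeasurable (hmean i)
      rw [(hlaw i).variance_eq, variance_id_gaussianReal] at h1
      simpa [pow_two] using h1.symm
    · rw [(hind.indepFun hij).integral_fun_mul_eq_mul_integral
        (hG i).aemeasurable.aestronglyMeasurable (hG j).aemeasurable.aestronglyMeasurable]
      simp [hmean]
  refine ⟨Ω, mΩ, P, horth.orthogonalFamily.linearIsometry.comp b.repr.toLinearIsometry, hP,
    fun h ↦ ?_⟩
  set W := horth.orthogonalFamily.linearIsometry.comp b.repr.toLinearIsometry with hW
  rw [← W.nnnorm_map h]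
  have hsum : HasSum (fun i ↦ b.repr h i • v i) (W h) := by
    have := horth.orthogonalFamily.hasSum_linearIsometry (b.repr h)
    simp only [LinearIsometry.toSpanSingleton_apply] at this
    exact this
  refine isClosed_setOf_hasLaw_gaussianReal_norm_sq.mem_of_tendsto hsum
    (Eventually.of_forall fun s ↦ ?_)
  have hae : (∑ i ∈ s, b.repr h i • v i : Lp ℝ 2 P) =ᵐ[P]
      fun ω ↦ ∑ i ∈ s, b.repr h i * ξ i ω := by
    have h1 : ∀ᵐ ω ∂P, ∀ i ∈ s, (b.repr h i • v i : Lp ℝ 2 P) ω = b.repr h i * ξ i ω := by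
      rw [Finset.eventually_all]
      intro i _
      filter_upwards [hv i, Lp.coeFn_smul (b.repr h i) (v i)] with ω h1 h2
      simp [h2, h1]
    filter_upwards [h1, Lp.coeFn_finsetSum s (fun i ↦ b.repr h i • v i)] with ω h1 h2
    rw [h2, Finset.sum_apply]
    exact Finset.sum_congr rfl h1
  refine hasLaw_gaussianReal_of_hasGaussianLaw_L2 (HasGaussianLaw.congr ?_ hae.symm) ?_
  · have hs : iIndepFun (fun (i : s) ω ↦ b.repr h i * ξ i ω) P :=
      (hind.precomp Subtype.val_injective).comp (fun (i : s) x ↦ b.repr h i * x)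
        fun i ↦ measurable_const_mul _
    have := iIndepFun.hasGaussianLaw_fun_sum (fun i : s ↦ (hG i).fun_smul (b.repr h i)) hs
    simp_rw [← Finset.sum_coe_sort s]
    exact this
  · rw [integral_congr_ae hae, integral_finsetSum _ fun i _ ↦ (hG i).integrable.const_mul _]
    simp [integral_const_mul, hmean]

/-- A pre-Brownian motion exists: evaluate the isonormal process over `L²(ℝ)` at the indicators of
the intervals `[0, t]`, whose inner products are `min s t`. -/
theorem exists_isPreBrownianReal :
    ∃ (Ω : Type) (_ : MeasurableSpace Ω) (P : Measure Ω) (X : ℝ≥0 → Ω → ℝ),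
      IsProbabilityMeasure P ∧ (∀ t, Measurable (X t)) ∧ IsPreBrownianReal X P := by
  obtain ⟨Ω, mΩ, P, W, hP, hW⟩ := exists_isonormal (Lp ℝ 2 (volume : Measure ℝ))
  let e : ℝ≥0 → Lp ℝ 2 (volume : Measure ℝ) := fun t ↦
    indicatorConstLp 2 (measurableSet_Icc (a := (0 : ℝ)) (b := t)) (by simp) (1 : ℝ)
  have he s t : ⟪e s, e t⟫_ℝ = min s t := by
    rw [L2.inner_indicatorConstLp_one_indicatorConstLp_one measurableSet_Icc measurableSet_Icc
      (by simp) (by simp)]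
    simp [Set.Icc_inter_Icc]
  have hmean h : P[W h] = 0 := by rw [(hW h).integral_eq]; simp
  have hG h : HasGaussianLaw (W h) P := (hW h).hasGaussianLaw
  have hX : IsPreBrownianReal (fun t ↦ W (e t)) P := by
    refine IsGaussianProcess.isPreBrownianReal_of_covariance ⟨fun I ↦ ?_⟩ (fun t ↦ hmean _)
      fun s t hst ↦ ?_
    · have hmeas : AEMeasurable (fun ω ↦ I.restrict (fun t ↦ W (e t) ω)) P :=
        aemeasurable_pi_lambda _ fun i ↦ (hG _).aemeasurable
      refine ⟨⟨fun L ↦ ?_⟩⟩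
      -- A linear combination of values of the isonormal process is again one of its values.
      have hae : W (∑ i : I, L (Pi.single i 1) • e i) =ᵐ[P]
          L ∘ fun ω ↦ I.restrict (fun t ↦ W (e t) ω) := by
        have h1 : ∀ᵐ ω ∂P, ∀ i : I, (L (Pi.single i 1) • W (e i) : Lp ℝ 2 P) ω =
            L (Pi.single i 1) * W (e i) ω := by
          rw [ae_all_iff]
          intro i
          filter_upwards [Lp.coeFn_smul (L (Pi.single i 1)) (W (e i))] with ω h2
          simp [h2]
        rw [map_sum]
        simp only [map_smul]
        filter_upwards [h1, Lp.coeFn_finsetSum Finset.univ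
          (fun i : I ↦ L (Pi.single i 1) • W (e i))] with ω h1 h2
        rw [h2, Finset.sum_apply, Function.comp_apply, ← L.coe_coe,
          LinearMap.pi_apply_eq_sum_univ]
        refine Finset.sum_congr rfl fun i _ ↦ ?_
        have hi : (fun j ↦ if i = j then (1 : ℝ) else 0) = Pi.single i 1 := by
          ext j
          simp [Pi.single_apply, eq_comm]
        rw [hi, smul_eq_mul, mul_comm]
        exact h1 i
      have hL := (hG (∑ i : I, L (Pi.single i 1) • e i)).congr hae
      rw [AEMeasurable.map_map_of_aemeasurable (by fun_prop) hmeas, hL.map_eq_gaussianReal,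
        integral_map hmeas (by fun_prop), variance_map (by fun_prop) hmeas]
      rfl
    · rw [covariance_eq_sub (hG _).memLp_two (hG _).memLp_two, hmean, hmean]
      have h1 : ⟪W (e s), W (e t)⟫_ℝ = P[⇑(W (e s)) * ⇑(W (e t))] := by
        rw [L2.inner_def]
        exact integral_congr_ae (.of_forall fun ω ↦ mul_comm _ _)
      rw [← h1, W.inner_map_map, he, min_eq_left (by exact_mod_cast hst)]
      simp
  have hsm t := Lp.stronglyMeasurable (W (e t))
  exact ⟨Ω, mΩ, P, fun t ↦ W (e t), hP, fun t ↦ (hsm t).measurable, hX⟩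

end Isonormal

/-! ### Chaining along dyadic approximations -/

section Dyadic

open Filter

/-- The largest dyadic number of level `m` which is at most `t`. -/
noncomputable def dyadicFloor (m : ℕ) (t : ℝ≥0) : ℝ≥0 := ⌊2 ^ m * t⌋₊ / 2 ^ m

theorem dyadicFloor_zero_right (m : ℕ) : dyadicFloor m 0 = 0 := by simp [dyadicFloor]

theorem dyadicFloor_le (m : ℕ) (t : ℝ≥0) : dyadicFloor m t ≤ t := by
  rw [dyadicFloor, div_le_iff₀ (by positivity), mul_comm t]
  exact Nat.floor_le (by positivity)

theorem le_dyadicFloor_add (m : ℕ) (t : ℝ≥0) : t ≤ dyadicFloor m t + (1 / 2) ^ m := by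
  rw [dyadicFloor, one_div, inv_pow, ← one_div, ← add_div, le_div_iff₀ (by positivity), mul_comm]
  exact (Nat.lt_floor_add_one _).le

theorem nndist_dyadicFloor_le (m : ℕ) (t : ℝ≥0) :
    nndist (dyadicFloor m t) t ≤ (1 / 2) ^ m := by
  rw [nndist_comm, NNReal.nndist_eq, tsub_eq_zero_of_le (dyadicFloor_le m t), max_eq_left zero_le,
    tsub_le_iff_left]
  exact le_dyadicFloor_add m t

theorem floor_two_pow_succ_mul (m : ℕ) (t : ℝ≥0) :
    ⌊2 ^ (m + 1) * t⌋₊ = 2 * ⌊2 ^ m * t⌋₊ ∨ ⌊2 ^ (m + 1) * t⌋₊ = 2 * ⌊2 ^ m * t⌋₊ + 1 := by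
  have h1 : 2 * ⌊2 ^ m * t⌋₊ ≤ ⌊2 ^ (m + 1) * t⌋₊ := by
    refine Nat.le_floor ?_
    push_cast
    rw [pow_succ', mul_assoc]
    gcongr
    exact Nat.floor_le (by positivity)
  have h2 : ⌊2 ^ (m + 1) * t⌋₊ < 2 * ⌊2 ^ m * t⌋₊ + 2 := by
    refine (Nat.floor_lt (by positivity)).2 ?_
    have := Nat.lt_floor_add_one (2 ^ m * t)
    push_cast
    calc 2 ^ (m + 1) * t = 2 * (2 ^ m * t) := by ring
      _ < 2 * (⌊2 ^ m * t⌋₊ + 1) := by gcongr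
      _ = _ := by ring
  omega

theorem floor_two_pow_mul_lt {N : ℕ} {t : ℝ≥0} (ht : t < N) (m : ℕ) :
    ⌊2 ^ m * t⌋₊ < N * 2 ^ m := by
  refine (Nat.floor_lt (by positivity)).2 ?_
  push_cast
  rw [mul_comm]
  gcongr

variable {x y : ℝ≥0 → ℝ} {N : ℕ} {C r : ℝ}

theorem dist_dyadicFloor_succ_le (hC : 0 ≤ C) (hr : 0 ≤ r)
    (hx : ∀ m k : ℕ, k < N * 2 ^ m → |x ((k + 1) / 2 ^ m) - x (k / 2 ^ m)| ≤ C * r ^ m)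
    {t : ℝ≥0} (ht : t < N) (m : ℕ) :
    dist (x (dyadicFloor m t)) (x (dyadicFloor (m + 1) t)) ≤ C * r * r ^ m := by
  have hk := floor_two_pow_mul_lt ht m
  have heq : dyadicFloor m t = ((2 * ⌊2 ^ m * t⌋₊ : ℕ) : ℝ≥0) / 2 ^ (m + 1) := by
    rw [dyadicFloor, pow_succ']
    push_cast
    rw [mul_div_mul_left _ _ two_ne_zero]
  rw [mul_assoc, ← pow_succ', heq]
  rcases floor_two_pow_succ_mul m t with h | h
  · rw [dyadicFloor, h, dist_self]
    positivity
  · rw [dyadicFloor, h, dist_comm, Real.dist_eq]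
    have := hx (m + 1) (2 * ⌊2 ^ m * t⌋₊) (by rw [pow_succ, ← mul_assoc]; omega)
    exact_mod_cast this

theorem dist_dyadicFloor_le (hC : 0 ≤ C) (hr : 0 ≤ r)
    (hx : ∀ m k : ℕ, k < N * 2 ^ m → |x ((k + 1) / 2 ^ m) - x (k / 2 ^ m)| ≤ C * r ^ m)
    {s t : ℝ≥0} (hs : s < N) (hst : s ≤ t) {m : ℕ} (hm : t ≤ s + (1 / 2) ^ m) :
    dist (x (dyadicFloor m s)) (x (dyadicFloor m t)) ≤ C * r ^ m := by
  have h1 : ⌊2 ^ m * s⌋₊ ≤ ⌊2 ^ m * t⌋₊ := by gcongr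
  have h2 : ⌊2 ^ m * t⌋₊ ≤ ⌊2 ^ m * s⌋₊ + 1 := by
    rw [← Nat.floor_add_one (by positivity)]
    gcongr
    calc 2 ^ m * t ≤ 2 ^ m * (s + (1 / 2) ^ m) := by gcongr
      _ = 2 ^ m * s + 1 := by rw [mul_add, ← mul_pow]; norm_num
  obtain h | h : ⌊2 ^ m * t⌋₊ = ⌊2 ^ m * s⌋₊ ∨ ⌊2 ^ m * t⌋₊ = ⌊2 ^ m * s⌋₊ + 1 := by omega
  · rw [dyadicFloor, dyadicFloor, h, dist_self]
    positivity
  · rw [dyadicFloor, dyadicFloor, h, dist_comm, Real.dist_eq]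
    have := hx m _ (floor_two_pow_mul_lt hs m)
    exact_mod_cast this

theorem exists_tendsto_dyadicFloor (hC : 0 ≤ C) (hr : 0 ≤ r) (hr1 : r < 1)
    (hx : ∀ m k : ℕ, k < N * 2 ^ m → |x ((k + 1) / 2 ^ m) - x (k / 2 ^ m)| ≤ C * r ^ m)
    {t : ℝ≥0} (ht : t < N) :
    ∃ a, Tendsto (fun m ↦ x (dyadicFloor m t)) atTop (𝓝 a) :=
  cauchySeq_tendsto_of_complete <|
    cauchySeq_of_le_geometric r (C * r) hr1 (dist_dyadicFloor_succ_le hC hr hx ht)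

/-- Modulus of continuity of the limit along dyadic approximations: replacing `s` and `t` by their
approximations of level `m` costs a geometric tail each, and these approximations are equal or
adjacent. -/
theorem dist_le_of_tendsto_dyadicFloor (hC : 0 ≤ C) (hr : 0 ≤ r) (hr1 : r < 1)
    (hx : ∀ m k : ℕ, k < N * 2 ^ m → |x ((k + 1) / 2 ^ m) - x (k / 2 ^ m)| ≤ C * r ^ m)
    (hy : ∀ t, Tendsto (fun m ↦ x (dyadicFloor m t)) atTop (𝓝 (y t)))
    {s t : ℝ≥0} (hs : s < N) (ht : t < N) {m : ℕ} (hm : dist s t ≤ (1 / 2) ^ m) :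
    dist (y s) (y t) ≤ (2 * (C * r / (1 - r)) + C) * r ^ m := by
  wlog hst : s ≤ t generalizing s t
  · rw [dist_comm]
    exact this ht hs (by rwa [dist_comm]) (le_of_not_ge hst)
  have htail {u : ℝ≥0} (hu : u < N) :
      dist (x (dyadicFloor m u)) (y u) ≤ C * r / (1 - r) * r ^ m := by
    rw [div_mul_eq_mul_div]
    exact dist_le_of_le_geometric_of_tendsto r (C * r) hr1
      (dist_dyadicFloor_succ_le hC hr hx hu) (hy u) m
  have hm' : t ≤ s + (1 / 2) ^ m := by
    have hst' : (s : ℝ) ≤ t := hst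
    rw [dist_comm, NNReal.dist_eq, abs_of_nonneg (by linarith)] at hm
    rw [← NNReal.coe_le_coe]
    push_cast
    linarith
  calc dist (y s) (y t)
      ≤ dist (y s) (x (dyadicFloor m s)) + dist (x (dyadicFloor m s)) (x (dyadicFloor m t)) +
          dist (x (dyadicFloor m t)) (y t) := dist_triangle4 _ _ _ _
    _ ≤ C * r / (1 - r) * r ^ m + C * r ^ m + C * r / (1 - r) * r ^ m := by
        gcongr
        · rw [dist_comm]
          exact htail hs
        · exact dist_dyadicFloor_le hC hr hx hs hst hm'
        · exact htail ht
    _ = _ := by ring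

/-- Deterministic part of the Kolmogorov–Chentsov theorem: if the increments of `x` between adjacent
dyadic numbers of level `m` are locally `O(2 ^ (-γ m))`, then the limit of `x` along dyadic
approximations is locally `γ`-Hölder. -/
theorem isLocallyHolder_of_tendsto_dyadicFloor {γ : ℝ≥0} (hγ : 0 < γ)
    (hx : ∀ N : ℕ, ∃ C : ℝ, 0 ≤ C ∧ ∀ m k : ℕ, k < N * 2 ^ m →
      |x ((k + 1) / 2 ^ m) - x (k / 2 ^ m)| ≤ C * ((1 / 2 : ℝ) ^ (γ : ℝ)) ^ m)
    (hy : ∀ t, Tendsto (fun m ↦ x (dyadicFloor m t)) atTop (𝓝 (y t))) :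
    IsLocallyHolder γ y := by
  intro t₀
  obtain ⟨N, hN⟩ := exists_nat_gt t₀
  obtain ⟨C, hC, hx⟩ := hx N
  set r : ℝ := (1 / 2 : ℝ) ^ (γ : ℝ) with hr
  have hr0 : 0 < r := by positivity
  have hr1 : r < 1 := Real.rpow_lt_one (by norm_num) (by norm_num) (by exact_mod_cast hγ)
  have hD : 0 ≤ 2 * (C * r / (1 - r)) + C := by
    have := sub_pos.2 hr1
    positivity
  obtain ⟨D, hD⟩ : ∃ D : ℝ≥0, (D : ℝ) = (2 * (C * r / (1 - r)) + C) / r :=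
    ⟨⟨_, by positivity⟩, rfl⟩
  refine ⟨Metric.ball t₀ (1 / 2) ∩ Set.Iio (N : ℝ≥0),
    inter_mem (Metric.ball_mem_nhds _ (by norm_num)) (Iio_mem_nhds hN), D,
    fun s hs t ht ↦ ?_⟩
  rw [edist_nndist, edist_nndist, ← ENNReal.coe_rpow_of_nonneg _ γ.coe_nonneg, ← ENNReal.coe_mul,
    ENNReal.coe_le_coe, ← NNReal.coe_le_coe]
  push_cast
  rw [hD]
  rcases eq_or_ne s t with rfl | hst
  · simp
    positivity
  have hlt : dist s t ≤ 1 := by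
    have h1 := Metric.mem_ball.1 hs.1
    have h2 := Metric.mem_ball.1 ht.1
    linarith [dist_triangle_right s t t₀]
  -- The level `m` is chosen so that `2 ^ (-m)` is comparable to the distance of `s` and `t`.
  obtain ⟨m, hm1, hm2⟩ :=
    exists_nat_pow_near_of_lt_one (dist_pos.2 hst) hlt (y := (1 / 2 : ℝ)) (by norm_num)
      (by norm_num)
  refine (dist_le_of_tendsto_dyadicFloor hC hr0.le hr1 hx hy hs.2 ht.2 hm2).trans ?_
  have hpow : r * r ^ m ≤ dist s t ^ (γ : ℝ) := by
    rw [← pow_succ', hr, ← Real.rpow_natCast, ← Real.rpow_mul (by norm_num), mul_comm,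
      Real.rpow_mul (by norm_num), Real.rpow_natCast]
    exact Real.rpow_le_rpow (by positivity) hm1.le γ.coe_nonneg
  rw [div_mul_eq_mul_div, le_div_iff₀ hr0, mul_assoc, mul_comm (r ^ m)]
  gcongr

theorem IsLocallyHolder.continuous {T E : Type*} [PseudoEMetricSpace T] [PseudoEMetricSpace E]
    {γ : ℝ≥0} {f : T → E} (hf : IsLocallyHolder γ f) (hγ : 0 < γ) : Continuous f := by
  rw [continuous_iff_continuousAt]
  intro t
  obtain ⟨U, hU, C, hC⟩ := hf t
  exact (hC.continuousOn hγ).continuousAt hU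

end Dyadic

/-! ### A locally Hölder modification -/

section Modification

open Filter
open scoped ENNReal

variable {Ω : Type*} {mΩ : MeasurableSpace Ω} {P : Measure Ω} {X : ℝ≥0 → Ω → ℝ}

theorem lintegral_enorm_pow_gaussianReal_ne_top (q : ℕ) :
    ∫⁻ x, ‖x‖ₑ ^ (2 * q) ∂gaussianReal 0 1 ≠ ∞ := by
  rcases eq_or_ne q 0 with rfl | hq
  · simp
  have h := (memLp_id_gaussianReal' (μ := 0) (v := 1) ((2 * q : ℕ) : ℝ≥0∞)
    (ENNReal.natCast_ne_top _))
  have h2 := lintegral_rpow_enorm_lt_top_of_eLpNorm_lt_top (by simpa using hq)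
    (ENNReal.natCast_ne_top _) h.2
  simpa only [ENNReal.toReal_natCast, ENNReal.rpow_natCast, id] using h2.ne

theorem lintegral_enorm_pow_gaussianReal (v : ℝ≥0) (q : ℕ) :
    ∫⁻ x, ‖x‖ₑ ^ (2 * q) ∂gaussianReal 0 v =
      (v : ℝ≥0∞) ^ q * ∫⁻ x, ‖x‖ₑ ^ (2 * q) ∂gaussianReal 0 1 := by
  have h : gaussianReal 0 v = (gaussianReal 0 1).map ((NNReal.sqrt v : ℝ) * ·) := by
    rw [gaussianReal_map_const_mul]
    congr 1
    · simp
    · ext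
      simp
  rw [h, lintegral_map (by fun_prop) (by fun_prop), ← lintegral_const_mul _ (by fun_prop)]
  refine lintegral_congr fun x ↦ ?_
  rw [enorm_mul, mul_pow, pow_mul ‖((NNReal.sqrt v : ℝ≥0) : ℝ)‖ₑ,
    Real.enorm_of_nonneg (NNReal.coe_nonneg _), ENNReal.ofReal_coe_nnreal, ← ENNReal.coe_pow,
    NNReal.sq_sqrt]

theorem ProbabilityTheory.IsPreBrownianReal.lintegral_enorm_sub_pow (hX : IsPreBrownianReal X P)
    (s t : ℝ≥0) (q : ℕ) :
    ∫⁻ ω, ‖X s ω - X t ω‖ₑ ^ (2 * q) ∂P =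
      (nndist s t : ℝ≥0∞) ^ q * ∫⁻ x, ‖x‖ₑ ^ (2 * q) ∂gaussianReal 0 1 := by
  rw [← lintegral_enorm_pow_gaussianReal]
  exact (hX.hasLaw_sub s t).lintegral_comp (f := fun x ↦ ‖x‖ₑ ^ (2 * q)) (by fun_prop)

/-- Weighted sum of the powers of order `2 (n + 2)` of the increments over adjacent dyadic numbers
up to time `N`. The weights are the largest integral powers of `2 ^ m` for which the expectation is
a convergent geometric series under Brownian scaling; a bound `S` on this sum bounds the increments
of level `m` by `S ^ (1 / (2 (n + 2))) * 2 ^ (-m n / (2 (n + 2)))`, and the Hölder exponents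
`n / (2 (n + 2))` increase to `1 / 2`. -/
noncomputable def dyadicVariation (n N : ℕ) (x : ℝ≥0 → ℝ) : ℝ≥0∞ :=
  ∑' m : ℕ, 2 ^ (m * n) * ∑ k ∈ Finset.range (N * 2 ^ m),
    ‖x ((k + 1) / 2 ^ m) - x (k / 2 ^ m)‖ₑ ^ (2 * (n + 2))

theorem measurable_dyadicVariation (hX : ∀ t, Measurable (X t)) (n N : ℕ) :
    Measurable fun ω ↦ dyadicVariation n N (X · ω) := by
  unfold dyadicVariation
  fun_prop

theorem nndist_dyadic_succ (m k : ℕ) :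
    nndist (((k : ℝ≥0) + 1) / 2 ^ m) ((k : ℝ≥0) / 2 ^ m) = (1 / 2) ^ m := by
  rw [add_div, NNReal.nndist_eq, add_tsub_cancel_left, tsub_eq_zero_of_le le_self_add,
    max_eq_left zero_le, one_div_pow]

theorem ProbabilityTheory.IsPreBrownianReal.ae_dyadicVariation_lt_top
    (hX : IsPreBrownianReal X P) (hm : ∀ t, Measurable (X t)) (n N : ℕ) :
    ∀ᵐ ω ∂P, dyadicVariation n N (X · ω) < ∞ := by
  refine ae_lt_top (measurable_dyadicVariation hm n N) ?_
  unfold dyadicVariation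
  rw [lintegral_tsum fun m ↦ by fun_prop]
  set c := ∫⁻ x, ‖x‖ₑ ^ (2 * (n + 2)) ∂gaussianReal 0 1 with hc
  have hterm (m : ℕ) : ∫⁻ ω, 2 ^ (m * n) * ∑ k ∈ Finset.range (N * 2 ^ m),
      ‖X ((k + 1) / 2 ^ m) ω - X (k / 2 ^ m) ω‖ₑ ^ (2 * (n + 2)) ∂P = N * c * 2⁻¹ ^ m := by
    rw [lintegral_const_mul _ (by fun_prop), lintegral_finsetSum _ fun k _ ↦ by fun_prop]
    simp only [hX.lintegral_enorm_sub_pow, nndist_dyadic_succ, ← hc]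
    have h2 : (2 : ℝ≥0∞) ^ m * 2⁻¹ ^ m = 1 := by
      rw [← mul_pow, ENNReal.mul_inv_cancel (by simp) (by simp), one_pow]
    rw [Finset.sum_const, Finset.card_range, nsmul_eq_mul]
    push_cast
    rw [one_div]
    calc (2 : ℝ≥0∞) ^ (m * n) * (N * 2 ^ m * ((2⁻¹ ^ m) ^ (n + 2) * c))
        = N * c * 2⁻¹ ^ m * (2 ^ m * 2⁻¹ ^ m) ^ (n + 1) := by ring
      _ = _ := by rw [h2]; simp
  simp only [hterm]
  rw [ENNReal.tsum_mul_left, ENNReal.tsum_geometric]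
  exact ENNReal.mul_ne_top
    (ENNReal.mul_ne_top (by simp) (lintegral_enorm_pow_gaussianReal_ne_top _)) (by simp)

theorem exists_abs_sub_le_of_dyadicVariation_lt_top {x : ℝ≥0 → ℝ} {n N : ℕ}
    (hx : dyadicVariation n N x < ∞) {γ : ℝ≥0} (hγ : γ * (2 * (n + 2)) ≤ n) :
    ∃ C : ℝ, 0 ≤ C ∧ ∀ m k : ℕ, k < N * 2 ^ m →
      |x ((k + 1) / 2 ^ m) - x (k / 2 ^ m)| ≤ C * ((1 / 2 : ℝ) ^ (γ : ℝ)) ^ m := by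
  set S := (dyadicVariation n N x).toReal with hS
  have hS0 : 0 ≤ S := ENNReal.toReal_nonneg
  -- For `C ≥ 1` the bound `S ≤ C` gives `S ≤ C ^ (2 * (n + 2))`, which avoids taking a root of `S`.
  set C : ℝ := max 1 S with hC
  refine ⟨C, by positivity, fun m k hk ↦ ?_⟩
  set d := x ((k + 1) / 2 ^ m) - x (k / 2 ^ m) with hd
  have h1 : (2 : ℝ) ^ (m * n) * |d| ^ (2 * (n + 2)) ≤ S := by
    have : (2 : ℝ≥0∞) ^ (m * n) * ‖d‖ₑ ^ (2 * (n + 2)) ≤ dyadicVariation n N x := by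
      refine le_trans ?_ (ENNReal.le_tsum m)
      gcongr
      exact Finset.single_le_sum
        (f := fun k : ℕ ↦ ‖x ((k + 1) / 2 ^ m) - x (k / 2 ^ m)‖ₑ ^ (2 * (n + 2)))
        (fun _ _ ↦ zero_le) (Finset.mem_range.2 hk)
    have := ENNReal.toReal_mono hx.ne this
    simpa using this
  set ρ : ℝ := (1 / 2 : ℝ) ^ (γ : ℝ) with hρ
  have hρ0 : 0 < ρ := by positivity
  have h2 : (1 / 2 : ℝ) ^ n ≤ ρ ^ (2 * (n + 2)) := by
    rw [hρ, ← Real.rpow_natCast, ← Real.rpow_natCast, ← Real.rpow_mul (by norm_num)]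
    refine Real.rpow_le_rpow_of_exponent_ge (by norm_num) (by norm_num) ?_
    push_cast
    exact_mod_cast hγ
  refine le_of_pow_le_pow_left₀ (n := 2 * (n + 2)) (by omega) (by positivity) ?_
  calc |d| ^ (2 * (n + 2))
      = (1 / 2) ^ (m * n) * (2 ^ (m * n) * |d| ^ (2 * (n + 2))) := by
        rw [← mul_assoc, ← mul_pow]
        norm_num
    _ ≤ (1 / 2) ^ (m * n) * C ^ (2 * (n + 2)) := by
        gcongr
        exact h1.trans ((le_max_right 1 S).trans
          (le_self_pow₀ (le_max_left 1 S) (by omega)))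
    _ = ((1 / 2) ^ n) ^ m * C ^ (2 * (n + 2)) := by rw [← pow_mul, mul_comm m]
    _ ≤ (ρ ^ (2 * (n + 2))) ^ m * C ^ (2 * (n + 2)) := by gcongr
    _ = (C * ρ ^ m) ^ (2 * (n + 2)) := by ring

theorem exists_nat_mul_le_of_lt_half {γ : ℝ≥0} (hγ : γ < 1 / 2) :
    ∃ n : ℕ, γ * (2 * (n + 2)) ≤ n := by
  obtain ⟨n, hn⟩ := exists_nat_ge (4 * (γ : ℝ) / (1 - 2 * γ))
  refine ⟨n, ?_⟩
  have h : (γ : ℝ) < 1 / 2 := by exact_mod_cast hγ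
  rw [div_le_iff₀ (by linarith)] at hn
  rw [← NNReal.coe_le_coe]
  push_cast
  linarith

/-- Almost sure limits along dyadic approximations are modifications: by Fatou's lemma the second
moment of `Y - X t` is at most `liminf nndist (dyadicFloor m t) t = 0`. -/
theorem ProbabilityTheory.IsPreBrownianReal.ae_eq_of_tendsto_dyadicFloor
    (hX : IsPreBrownianReal X P) (hm : ∀ t, Measurable (X t)) {Y : Ω → ℝ} {t : ℝ≥0}
    (hY : ∀ᵐ ω ∂P, Tendsto (fun m ↦ X (dyadicFloor m t) ω) atTop (𝓝 (Y ω))) :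
    X t =ᵐ[P] Y := by
  have hmY : AEMeasurable Y P := aemeasurable_of_tendsto_metrizable_ae atTop
    (fun m ↦ (hm (dyadicFloor m t)).aemeasurable) hY
  have hlim : ∀ᵐ ω ∂P, ‖Y ω - X t ω‖ₑ ^ 2 =
      liminf (fun m ↦ ‖X (dyadicFloor m t) ω - X t ω‖ₑ ^ 2) atTop := by
    filter_upwards [hY] with ω hω
    exact (((ENNReal.continuous_pow 2).tendsto _).comp
      (hω.sub_const (X t ω)).enorm).liminf_eq.symm
  set c := ∫⁻ x, ‖x‖ₑ ^ (2 * 1) ∂gaussianReal 0 1 with hc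
  have h0 : ∫⁻ ω, ‖Y ω - X t ω‖ₑ ^ 2 ∂P = 0 := by
    rw [lintegral_congr_ae hlim, ← nonpos_iff_eq_zero]
    refine (lintegral_liminf_le fun m ↦ by fun_prop).trans ?_
    have hint (m : ℕ) : ∫⁻ ω, ‖X (dyadicFloor m t) ω - X t ω‖ₑ ^ 2 ∂P ≤ 2⁻¹ ^ m * c := by
      have := hX.lintegral_enorm_sub_pow (dyadicFloor m t) t 1
      rw [mul_one, pow_one] at this
      rw [this, hc, mul_one]
      gcongr
      have := nndist_dyadicFloor_le m t
      rw [one_div] at this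
      have h2 := ENNReal.coe_le_coe.2 this
      rwa [ENNReal.coe_pow, ENNReal.coe_inv two_ne_zero] at h2
    have h2 : Tendsto (fun m : ℕ ↦ (2⁻¹ : ℝ≥0∞) ^ m * c) atTop (𝓝 0) := by
      simpa using ENNReal.Tendsto.mul_const
        (ENNReal.tendsto_pow_atTop_nhds_zero_of_lt_one (r := 2⁻¹) (by simp))
        (Or.inr (lintegral_enorm_pow_gaussianReal_ne_top 1))
    exact (liminf_le_liminf (.of_forall hint)).trans h2.liminf_eq.le
  rw [lintegral_eq_zero_iff' (by fun_prop)] at h0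
  filter_upwards [h0] with ω hω
  have : Y ω - X t ω = 0 := by simpa using hω
  linarith

/-- **Kolmogorov–Chentsov theorem** for pre-Brownian motions. The exceptional null set, on which the
modification is set to `0`, is a measurable set common to all exponents and all times. -/
theorem ProbabilityTheory.IsPreBrownianReal.exists_modification_isLocallyHolder
    (hX : IsPreBrownianReal X P) (hm : ∀ t, Measurable (X t)) :
    ∃ B : ℝ≥0 → Ω → ℝ, (∀ t, Measurable (B t)) ∧ (∀ t, X t =ᵐ[P] B t) ∧ (∀ ω, B 0 ω = 0) ∧
      ∀ ω, ∀ γ : ℝ≥0, 0 < γ → γ < 1 / 2 → IsLocallyHolder γ (fun t ↦ B t ω) := by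
  let A : Set Ω := {ω | X 0 ω = 0} ∩ ⋂ n, ⋂ N, {ω | dyadicVariation n N (X · ω) < ∞}
  have hA : MeasurableSet A := (measurableSet_eq_fun (hm 0) measurable_const).inter <|
    .iInter fun n ↦ .iInter fun N ↦
      measurableSet_lt (measurable_dyadicVariation hm n N) measurable_const
  have hAae : ∀ᵐ ω ∂P, ω ∈ A := by
    filter_upwards [hX.eval_zero_ae_eq_zero,
      ae_all_iff.2 fun n ↦ ae_all_iff.2 fun N ↦ hX.ae_dyadicVariation_lt_top hm n N] with ω h1 h2
    exact ⟨h1, Set.mem_iInter₂.2 h2⟩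
  let Z : ℝ≥0 → Ω → ℝ := fun t ↦ A.indicator (X t)
  have hZ ω {γ : ℝ≥0} (hγ : γ < 1 / 2) (N : ℕ) : ∃ C : ℝ, 0 ≤ C ∧ ∀ m k : ℕ, k < N * 2 ^ m →
      |Z ((k + 1) / 2 ^ m) ω - Z (k / 2 ^ m) ω| ≤ C * ((1 / 2 : ℝ) ^ (γ : ℝ)) ^ m := by
    by_cases hω : ω ∈ A
    · obtain ⟨n, hn⟩ := exists_nat_mul_le_of_lt_half hγ
      simpa [Z, hω] using exists_abs_sub_le_of_dyadicVariation_lt_top (Set.mem_iInter₂.1 hω.2 n N) hn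
    · exact ⟨0, le_rfl, by simp [Z, hω]⟩
  have hlim t ω : ∃ a, Tendsto (fun m ↦ Z (dyadicFloor m t) ω) atTop (𝓝 a) := by
    obtain ⟨N, hN⟩ := exists_nat_gt t
    obtain ⟨C, hC, h⟩ := hZ ω (γ := 1 / 4) (by rw [← NNReal.coe_lt_coe]; norm_num) N
    exact exists_tendsto_dyadicFloor (x := fun t ↦ Z t ω) hC (by positivity)
      (Real.rpow_lt_one (by norm_num) (by norm_num) (by norm_num)) h hN
  choose B hB using hlim
  refine ⟨B, fun t ↦ ?_, fun t ↦ ?_, fun ω ↦ ?_, fun ω γ h0 h1 ↦ ?_⟩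
  · exact measurable_of_tendsto_metrizable (fun m ↦ (hm (dyadicFloor m t)).indicator hA)
      (tendsto_pi_nhds.2 (hB t))
  · refine hX.ae_eq_of_tendsto_dyadicFloor hm ?_
    filter_upwards [hAae] with ω hω
    simpa [Z, hω] using hB t ω
  · have hZ0 : Z 0 ω = 0 := by
      by_cases hω : ω ∈ A
      · simpa [Z, hω] using hω.1
      · simp [Z, hω]
    refine tendsto_nhds_unique (hB 0 ω) ?_
    simp [dyadicFloor_zero_right, hZ0]
  · exact isLocallyHolder_of_tendsto_dyadicFloor (x := fun t ↦ Z t ω) h0 (hZ ω h1) fun t ↦ hB t ω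

end Modification

/-! ### Finite-dimensional laws at arbitrary finite families of times -/

section FiniteDimensional

variable {Ω : Type*} {mΩ : MeasurableSpace Ω} {P : Measure Ω} {B : ℝ≥0 → Ω → ℝ}

/-- The times need not be distinct, so that the covariance matrix may be singular; the two Gaussian
laws agree because their means and covariances do. -/
theorem ProbabilityTheory.IsPreBrownianReal.hasLaw_multivariateGaussian
    (hB : IsPreBrownianReal B P) {n : ℕ} (t : Fin n → ℝ≥0) :
    HasLaw (fun ω ↦ WithLp.toLp 2 (fun i ↦ B (t i) ω))
      (multivariateGaussian 0 (brownianCov t)) P := by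
  have hP := hB.isGaussianProcess.isProbabilityMeasure
  have hLp i : MemLp (B (t i)) 2 P := (hB.isGaussianProcess.hasGaussianLaw_eval (t i)).memLp_two
  have hG : HasGaussianLaw (fun ω ↦ WithLp.toLp 2 (fun i ↦ B (t i) ω)) P := by
    let L : (Finset.univ.image t → ℝ) →L[ℝ] (Fin n → ℝ) :=
      .pi fun i ↦ .proj ⟨t i, Finset.mem_image_of_mem t (Finset.mem_univ i)⟩
    exact ((hB.isGaussianProcess.hasGaussianLaw (Finset.univ.image t)).map L).toLp_pi 2
  refine ⟨hG.aemeasurable, ?_⟩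
  have := hG.isGaussian_map
  refine IsGaussian.ext ?_ ?_
  · rw [integral_id_multivariateGaussian', integral_map hG.aemeasurable (by fun_prop)]
    ext i
    change (EuclideanSpace.proj i : EuclideanSpace ℝ (Fin n) →L[ℝ] ℝ) _ = 0
    simp only [id_eq]
    rw [← ContinuousLinearMap.integral_comp_comm _ hG.integrable]
    exact hB.integral_eval (t i)
  · ext x y
    rw [covarianceBilin_apply_pi hLp,
      covarianceBilin_multivariateGaussian (brownianCov_posSemidef t)]
    simp only [hB.covariance_eval, dotProduct, Matrix.mulVec, Finset.mul_sum]
    refine Finset.sum_congr rfl fun i _ ↦ Finset.sum_congr rfl fun j _ ↦ ?_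
    rw [brownianCov, Matrix.of_apply]
    ring

end FiniteDimensional

/-! ### The Borel σ-algebra of the space of paths and the Wiener measure -/

section Paths

open scoped ENNReal
open TopologicalSpace Set

/-- If the domain is pseudometrizable, second countable and locally compact, and the target is
pseudometric and second countable, the Borel σ-algebra of the compact-open topology is generated by the evaluations: a
continuous map sends a compact set into an open set `U` if and only if, for some `n`, it sends a
countable dense subset to points at distance at least `1 / (n + 1)` from the complement of `U`. -/
theorem borel_continuousMap_eq_comap {S E : Type*} [TopologicalSpace S] [PseudoMetrizableSpace S]
    [SecondCountableTopology S] [LocallyCompactSpace S] [PseudoEMetricSpace E]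
    [SecondCountableTopology E] [MeasurableSpace E] [BorelSpace E] :
    borel C(S, E) = MeasurableSpace.comap (fun f : C(S, E) ↦ (f : S → E)) MeasurableSpace.pi := by
  refine le_antisymm ?_ ?_
  · rw [borel_eq_generateFrom_of_subbasis ContinuousMap.compactOpen_eq]
    refine MeasurableSpace.generateFrom_le ?_
    rintro _ ⟨K, hK, U, hU, rfl⟩
    obtain ⟨D, hDK, hD, hKD⟩ := hK.isSeparable.exists_countable_dense_subset
    refine ⟨⋃ n : ℕ, ⋂ d ∈ D, {f : S → E | ((n : ℝ≥0∞) + 1)⁻¹ ≤ Metric.infEDist (f d) Uᶜ}, ?_, ?_⟩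
    · refine .iUnion fun n ↦ .biInter hD fun d _ ↦ measurableSet_le measurable_const ?_
      exact Metric.continuous_infEDist.measurable.comp (measurable_pi_apply d)
    · ext f
      simp only [preimage_iUnion, preimage_iInter, preimage_ofPred_eq, mem_iUnion, mem_iInter,
        mem_ofPred_eq]
      constructor
      · rintro ⟨n, hn⟩ s hs
        have hcl : IsClosed {s : S | ((n : ℝ≥0∞) + 1)⁻¹ ≤ Metric.infEDist (f s) Uᶜ} :=
          isClosed_le continuous_const (Metric.continuous_infEDist.comp f.continuous)
        have hs' : ((n : ℝ≥0∞) + 1)⁻¹ ≤ Metric.infEDist (f s) Uᶜ :=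
          closure_minimal (fun d hd ↦ hn d hd) hcl (hKD hs)
        by_contra hsU
        rw [Metric.infEDist_zero_of_mem hsU] at hs'
        simp at hs'
      · intro hf
        obtain ⟨r, hr, hfr⟩ := Metric.exists_pos_forall_lt_edist (hK.image f.continuous)
          hU.isClosed_compl (disjoint_compl_right_iff_subset.2 (mapsTo_iff_image_subset.1 hf))
        obtain ⟨n, hn⟩ := ENNReal.exists_inv_nat_lt (a := r) (by simpa using hr.ne')
        refine ⟨n, fun d hd ↦ Metric.le_infEDist.2 fun e he ↦ ?_⟩
        refine le_trans ?_ (hfr _ (mem_image_of_mem f (hDK hd)) e he).le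
        exact (ENNReal.inv_le_inv.2 le_self_add).trans hn.le
  · rw [← measurable_iff_comap_le]
    borelize C(S, E)
    exact measurable_pi_iff.2 fun s ↦ (continuous_eval_const s).measurable

theorem measurable_coe_path : Measurable fun f : C(ℝ≥0, ℝ) ↦ (f : ℝ≥0 → ℝ) :=
  measurable_pi_iff.2 fun t ↦ (continuous_eval_const t).measurable

theorem measurable_pathMap {Ω : Type*} [MeasurableSpace Ω] {B : ℝ≥0 → Ω → ℝ}
    (hm : ∀ t, Measurable (B t)) (hc : ∀ ω, Continuous fun t ↦ B t ω) :
    Measurable (pathMap B hc) := by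
  rw [BorelSpace.measurable_eq (α := C(ℝ≥0, ℝ)), borel_continuousMap_eq_comap,
    measurable_comap_iff]
  exact measurable_pi_iff.2 hm

theorem IsWienerMeasure.isProjectiveLimit {W : Measure C(ℝ≥0, ℝ)} (hW : IsWienerMeasure W) :
    IsProjectiveLimit (W.map fun f : C(ℝ≥0, ℝ) ↦ (f : ℝ≥0 → ℝ))
      BrownianReal.projectiveFamily := by
  intro I
  rw [Measure.map_map (Finset.measurable_restrict I) measurable_coe_path]
  exact (hW.hasLaw I).map_eq

theorem IsWienerMeasure.unique {W W' : Measure C(ℝ≥0, ℝ)} (hW : IsWienerMeasure W)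
    (hW' : IsWienerMeasure W') : W = W' := by
  have h := hW.isProjectiveLimit.unique hW'.isProjectiveLimit
  ext s hs
  rw [BorelSpace.measurable_eq (α := C(ℝ≥0, ℝ)), borel_continuousMap_eq_comap] at hs
  obtain ⟨s, hs, rfl⟩ := hs
  rw [← Measure.map_apply measurable_coe_path hs, h, Measure.map_apply measurable_coe_path hs]

theorem ProbabilityTheory.IsPreBrownianReal.isWienerMeasure_map_pathMap {Ω : Type*}
    {mΩ : MeasurableSpace Ω} {P : Measure Ω} {B : ℝ≥0 → Ω → ℝ} (hB : IsPreBrownianReal B P)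
    (hm : ∀ t, Measurable (B t)) (hc : ∀ ω, Continuous fun t ↦ B t ω) :
    IsWienerMeasure (P.map (pathMap B hc)) where
  hasLaw I := by
    have hr : Measurable fun f : C(ℝ≥0, ℝ) ↦ I.restrict (f : ℝ≥0 → ℝ) :=
      (Finset.measurable_restrict I).comp measurable_coe_path
    refine ⟨hr.aemeasurable, ?_⟩
    rw [Measure.map_map hr (measurable_pathMap hm hc)]
    exact (hB.hasLaw I).map_eq
  cont := .of_forall fun f ↦ f.continuous

end Paths

/-- **Construction of Brownian motion and of the Wiener measure.** -/
theorem mainTheorem1 :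
    ∃ (Ω : Type) (_ : MeasurableSpace Ω) (P : Measure Ω) (B : ℝ≥0 → Ω → ℝ),
      IsProbabilityMeasure P ∧
      (∀ t, Measurable (B t)) ∧
      (∀ ω, B 0 ω = 0) ∧
      (∀ (n : ℕ) (t : Fin n → ℝ≥0),
        HasLaw (fun ω => WithLp.toLp 2 (fun i => B (t i) ω))
          (multivariateGaussian 0 (brownianCov t)) P) ∧
      IsBrownianReal B P ∧
      (∀ ω, ∀ γ : ℝ≥0, 0 < γ → γ < 1 / 2 → IsLocallyHolder γ (fun t => B t ω)) ∧
      ∃ hcont : ∀ ω, Continuous fun t => B t ω,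
        Measurable (pathMap B hcont) ∧
        IsWienerMeasure (P.map (pathMap B hcont)) ∧
        ∀ W : Measure C(ℝ≥0, ℝ), IsWienerMeasure W → W = P.map (pathMap B hcont) := by
  obtain ⟨Ω, mΩ, P, X, hP, hXm, hX⟩ := exists_isPreBrownianReal
  obtain ⟨B, hm, hXB, hB0, hHolder⟩ := hX.exists_modification_isLocallyHolder hXm
  have hB : IsPreBrownianReal B P := hX.congr hXB
  have hcont ω : Continuous fun t ↦ B t ω :=
    (hHolder ω (1 / 4) (by positivity) (by rw [← NNReal.coe_lt_coe]; norm_num)).continuous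
      (by positivity)
  have hW := hB.isWienerMeasure_map_pathMap hm hcont
  exact ⟨Ω, mΩ, P, B, hP, hm, hB0, fun n t ↦ hB.hasLaw_multivariateGaussian t,
    ⟨hB, .of_forall hcont⟩, hHolder, hcont, measurable_pathMap hm hcont, hW,
    fun W h ↦ h.unique hW⟩
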